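/- Let $\Phi$ be a unital qubit channel, i.e. a completely positive, trace-preserving linear map on $2\times 2$ complex matrices with $\Phi(I)=I$. All logarithms are to base $2$; $S(\rho)=-\operatorname{Tr}(\rho\log_2\rho)$ and $h(q)=-q\log_2 q-(1-q)\log_2(1-q)$. A state is a positive semidefinite $2\times2$ matrix of trace one. Let $$\chi(\Phi)=\sup_{p\in[0,1],\ \rho,\rho'\text{ states}}\Big(S\big(\Phi(p\rho+(1-p)\rho')\big)-p\,S(\Phi(\rho))-(1-p)\,S(\Phi(\rho'))\Big)$$ (the single-letter formula for the classical capacity of $\Phi$), and let $M_\Phi=\sup_{\rho}\|\Phi(\rho)\|$, the supremum over states $\rho$ of the operator norm. Both suprema are finite and $\tfrac12\le M_\Phi\le 1$. Let $\mathcal R_\Phi$ be the set of states $\rho$ with $\|\Phi(\rho)\|=M_\Phi$, and for $\rho\in\mathcal R_\Phi$ let $\Gamma_{\Phi,\rho}$ be the set of states $\tau$ with $\operatorname{Tr}(\Phi(\rho)\tau)=M_\Phi$. Then $\mathcal R_\Phi\neq\emptyset$, and for every $\rho\in\mathcal R_\Phi$ the set $\Gamma_{\Phi,\rho}$ contains an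 orthogonal projector. Let $\rho^*\in\mathcal R_\Phi$ and $\tau^*\in\Gamma_{\Phi,\rho^*}$ be arbitrary. Encode the bit $0$ as $\rho^*$ and the bit $1$ as $I-\rho^*$, and measure each channel output with $\{P_0=I-\tau^*,\ P_1=\tau^*\}$. Then $I-\rho^*$ is a state, $\{P_0,P_1\}$ is a POVM, and it consists of orthogonal projectors if $M_\Phi\ne\tfrac12$. Moreover: 1. The induced classical channel $p(y|x)$ of one use of $\Phi$ is the binary symmetric channel $\mathrm{BSC}(M_\Phi)$ with flip probability $M_\Phi$; used qubit by qubit over $\Phi^{\otimes n}$, the scheme induces $n$ independent uses of $\mathrm{BSC}(M_\Phi)$, for every $n$. 2. The Shannon capacity $\max_{p(x)}I(X;Y)$ of the induced channel is $1-h(M_\Phi)$, and $1-h(M_\Phi)=\chi(\Phi)$. 3. Consequently the scheme achieves $\chi(\Phi)$: there are sequences of classical block codes of length $n=0,1,2,\dots$ whose rate tends to the Shannon capacity of $\mathrm{BSC}(M_\Phi)$ and whose maximal error probability over $\mathrm{BSC}(M_\Phi)$ tends to $0$; and every such sequence, combined with the product encoding and product measurement above over $\Phi^{\otimes n}$, has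 rate tending to $\chi(\Phi)$ and maximal error probability tending to $0$. -/

import Mathlib

open scoped ComplexOrder Matrix

namespace UnitalQubit

/-! ### Qubit states and unital qubit channels -/

/-- Operators on the Hilbert space of one qubit. -/
abbrev Op : Type := Matrix (Fin 2) (Fin 2) ℂ

/-- Density operators: positive semidefinite with unit trace. -/
def IsState (ρ : Op) : Prop := ρ.PosSemidef ∧ ρ.trace = 1

/-- The ampliation `Φ ⊗ id` acting on operators on the tensor product of the qubit with a
`k`-dimensional reference system: `Φ` is applied to each of the `k × k` qubit blocks. -/
def ampliation (Φ : Op →ₗ[ℂ] Op) (k : ℕ) (X : Matrix (Fin 2 × Fin k) (Fin 2 × Fin k) ℂ) :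
    Matrix (Fin 2 × Fin k) (Fin 2 × Fin k) ℂ :=
  Matrix.of fun a b => Φ (Matrix.of fun i j => X (i, a.2) (j, b.2)) a.1 b.1

/-- Complete positivity: all ampliations preserve positive semidefiniteness. -/
def IsCompletelyPositive (Φ : Op →ₗ[ℂ] Op) : Prop :=
  ∀ (k : ℕ) (X : Matrix (Fin 2 × Fin k) (Fin 2 × Fin k) ℂ),
    X.PosSemidef → (ampliation Φ k X).PosSemidef

/-- A unital qubit channel: completely positive, trace preserving, and `Φ(I) = I`. -/
structure IsUnitalQubitChannel (Φ : Op →ₗ[ℂ] Op) : Prop where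
  completely_positive : IsCompletelyPositive Φ
  trace_preserving : ∀ A : Op, (Φ A).trace = A.trace
  unital : Φ 1 = 1

/-- The operator norm with respect to the Euclidean norm on `ℂ²`. -/
noncomputable def opNorm (A : Op) : ℝ := ‖Matrix.toEuclideanCLM (n := Fin 2) (𝕜 := ℂ) A‖

/-- The operator norms of all channel outputs. -/
def outputNorms (Φ : Op →ₗ[ℂ] Op) : Set ℝ := {x | ∃ ρ : Op, IsState ρ ∧ x = opNorm (Φ ρ)}

/-- The maximal output norm `M_Φ = sup_ρ ‖Φ(ρ)‖`. -/
noncomputable def maxOutputNorm (Φ : Op →ₗ[ℂ] Op) : ℝ := sSup (outputNorms Φ)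

/-- The states that attain the supremum `M_Φ`. -/
def normMaximizers (Φ : Op →ₗ[ℂ] Op) : Set Op :=
  {ρ | IsState ρ ∧ opNorm (Φ ρ) = maxOutputNorm Φ}

/-- The states `τ` with `Tr(Φ(ρ) τ) = M_Φ`. -/
def detectors (Φ : Op →ₗ[ℂ] Op) (ρ : Op) : Set Op :=
  {τ | IsState τ ∧ (Φ ρ * τ).trace = (maxOutputNorm Φ : ℂ)}

/-! ### Entropies (in bits) and the Holevo information -/

open Classical in
/-- The von Neumann entropy `-Tr(ρ log₂ ρ)`, computed from the eigenvalues of the Hermitian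
operator `ρ` (and set to `0` for other operators). -/
noncomputable def vonNeumannEntropy (ρ : Op) : ℝ :=
  if h : ρ.IsHermitian then -∑ i, h.eigenvalues i * Real.logb 2 (h.eigenvalues i) else 0

/-- The values `S(Φ(pρ + (1-p)ρ')) - p S(Φ(ρ)) - (1-p) S(Φ(ρ'))` over all probabilities `p`
and states `ρ`, `ρ'`. -/
def holevoValues (Φ : Op →ₗ[ℂ] Op) : Set ℝ :=
  {x | ∃ (p : ℝ) (ρ ρ' : Op), 0 ≤ p ∧ p ≤ 1 ∧ IsState ρ ∧ IsState ρ' ∧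
    x = vonNeumannEntropy (Φ (p • ρ + (1 - p) • ρ'))
      - p * vonNeumannEntropy (Φ ρ) - (1 - p) * vonNeumannEntropy (Φ ρ')}

/-- The Holevo information `χ(Φ)` of a unital qubit channel. -/
noncomputable def holevoInformation (Φ : Op →ₗ[ℂ] Op) : ℝ := sSup (holevoValues Φ)

/-- The binary entropy function `h`, in bits. -/
noncomputable def binaryEntropy (q : ℝ) : ℝ :=
  -(q * Real.logb 2 q + (1 - q) * Real.logb 2 (1 - q))

/-- The Shannon entropy, in bits, of a distribution on a finite set. -/
noncomputable def shannonEntropy {X : Type*} [Fintype X] (p : X → ℝ) : ℝ :=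
  -∑ x, p x * Real.logb 2 (p x)

/-! ### Classical channels

A classical channel is given by its transition probabilities: `W x y` is the probability of the
output `y` when the input is `x`. -/

/-- The mutual information `H(X) + H(Y) - H(X,Y)` for the input distribution `p`. -/
noncomputable def mutualInformation {X Y : Type*} [Fintype X] [Fintype Y]
    (W : X → Y → ℝ) (p : X → ℝ) : ℝ :=
  shannonEntropy p + shannonEntropy (fun y => ∑ x, p x * W x y)
    - shannonEntropy (fun z : X × Y => p z.1 * W z.1 z.2)

/-- The mutual informations for all input distributions. -/
def mutualInformations {X Y : Type*} [Fintype X] [Fintype Y] (W : X → Y → ℝ) : Set ℝ :=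
  mutualInformation W '' stdSimplex ℝ X

/-- The Shannon capacity of a classical channel. -/
noncomputable def shannonCapacity {X Y : Type*} [Fintype X] [Fintype Y] (W : X → Y → ℝ) : ℝ :=
  sSup (mutualInformations W)

/-- The binary symmetric channel with flip probability `q`. -/
def bsc (q : ℝ) (x y : Fin 2) : ℝ := if x = y then 1 - q else q

/-- `n` independent uses of a classical binary channel. -/
def memoryless (W : Fin 2 → Fin 2 → ℝ) (n : ℕ) (x y : Fin n → Fin 2) : ℝ := ∏ i, W (x i) (y i)

/-- A classical block code of length `n` over a binary alphabet, with its decoder. -/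
structure BlockCode (n : ℕ) where
  /-- number of messages -/
  size : ℕ
  encode : Fin size → (Fin n → Fin 2)
  decode : (Fin n → Fin 2) → Fin size

/-- The probability that message `m` is decoded incorrectly when codewords of length `n` are
received with the transition probabilities `V`. -/
def errorProb {n : ℕ} (V : (Fin n → Fin 2) → (Fin n → Fin 2) → ℝ) (c : BlockCode n)
    (m : Fin c.size) : ℝ :=
  ∑ y, if c.decode y = m then 0 else V (c.encode m) y

/-- The sequence of codes `c n` of length `n` has rate tending to `R` (in bits per channel use)
and maximal error probability tending to `0`, when blocks of length `n` are received with the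
transition probabilities `V n`. -/
def AchievesRate (V : (n : ℕ) → (Fin n → Fin 2) → (Fin n → Fin 2) → ℝ)
    (c : (n : ℕ) → BlockCode n) (R : ℝ) : Prop :=
  Filter.Tendsto (fun n : ℕ => Real.logb 2 ((c n).size : ℝ) / (n : ℝ)) Filter.atTop (nhds R) ∧
  Filter.Tendsto (fun n : ℕ => ⨆ m, errorProb (V n) (c n) m) Filter.atTop (nhds 0)

/-! ### The product encoding and decoding scheme -/

/-- Bit `0` is encoded as `ρ` and bit `1` as `I - ρ`. -/
def encoder (ρ : Op) : Fin 2 → Op := ![ρ, 1 - ρ]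

/-- The measurement `{P₀ = I - τ, P₁ = τ}`. -/
def measurement (τ : Op) : Fin 2 → Op := ![1 - τ, τ]

/-- A measurement with outcomes in `Y`: positive operators that sum to the identity. -/
def IsPOVM {Y : Type*} [Fintype Y] (P : Y → Op) : Prop :=
  (∀ y, (P y).PosSemidef) ∧ ∑ y, P y = 1

/-- The induced classical channel for one use of `Φ`, with transition probabilities
`p(y|x) = Tr(P_y Φ(E_x))`. -/
def inducedChannel (Φ : Op →ₗ[ℂ] Op) (E P : Fin 2 → Op) (x y : Fin 2) : ℝ :=
  (P y * Φ (E x)).trace.re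

/-- The product operator `A₁ ⊗ ⋯ ⊗ Aₙ` on `n` qubits. -/
def productOp {n : ℕ} (A : Fin n → Op) : Matrix (Fin n → Fin 2) (Fin n → Fin 2) ℂ :=
  Matrix.of fun a b => ∏ i, A i (a i) (b i)

/-- The `n`-fold tensor power `Φ ⊗ ⋯ ⊗ Φ`: the linear map that sends each tensor product of
matrix units `⊗ᵢ |aᵢ⟩⟨bᵢ|` to `⊗ᵢ Φ(|aᵢ⟩⟨bᵢ|)`. -/
def tensorPower (Φ : Op →ₗ[ℂ] Op) (n : ℕ) (X : Matrix (Fin n → Fin 2) (Fin n → Fin 2) ℂ) :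
    Matrix (Fin n → Fin 2) (Fin n → Fin 2) ℂ :=
  ∑ a, ∑ b, X a b • productOp fun i => Φ (Matrix.single (a i) (b i) 1)

/-- The probability of observing the string `y` when the string `x` is encoded qubit by qubit
with `E`, sent through `n` independent uses of `Φ`, and measured qubit by qubit with `P`. -/
def inducedBlockChannel (Φ : Op →ₗ[ℂ] Op) (E P : Fin 2 → Op) (n : ℕ)
    (x y : Fin n → Fin 2) : ℝ :=
  (productOp (fun i => P (y i)) * tensorPower Φ n (productOp fun i => E (x i))).trace.re

end UnitalQubit

/-!
The spectrum of a qubit state is `{‖ρ‖, 1 - ‖ρ‖}`, so its entropy is `h(‖ρ‖)`, which decreases in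
the norm. Hence no output of `Φ` has entropy below `h(M_Φ)`, and `χ(Φ) ≤ 1 - h(M_Φ)`. If `ρ*`
attains `M_Φ`, then so does `1 - ρ*`, and because `Φ` is unital the two outputs average to `1 / 2`,
whose entropy is one bit: this gives equality. A state `τ*` with `Tr(Φ(ρ*) τ*) = M_Φ` detects
`Φ(ρ*)` with probability `M_Φ` and `1 - Φ(ρ*)` with probability `1 - M_Φ`, which is the binary
symmetric channel, and all traces factor over tensor products.

Capacity-achieving codes come from Feinstein's lemma: choose codewords greedily, and decode each to
those outputs `y` not yet used for which `W(y|x)` exceeds the output probability of `y` by a factor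
`2 ^ (n I - t)`. By Chebyshev's inequality for the information density, such `y` carry all but
`n V / t ^ 2` of the probability; `t = n ^ (3 / 4) + 1` makes this tend to `0` at no cost in rate.
-/

namespace UnitalQubit

/-! ### Mutual information of classical channels -/

theorem binaryEntropy_eq_binEntropy_div (q : ℝ) :
    binaryEntropy q = Real.binEntropy q / Real.log 2 := by
  simp only [binaryEntropy, Real.logb, Real.binEntropy, Real.log_inv]
  ring

theorem binaryEntropy_half : binaryEntropy (1 / 2) = 1 := by
  rw [binaryEntropy_eq_binEntropy_div, one_div, Real.binEntropy_two_inv,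
    div_self (Real.log_pos one_lt_two).ne']

theorem binaryEntropy_le_one (q : ℝ) : binaryEntropy q ≤ 1 := by
  rw [binaryEntropy_eq_binEntropy_div, div_le_one (Real.log_pos one_lt_two)]
  exact Real.binEntropy_le_log_two

theorem antitoneOn_binaryEntropy : AntitoneOn binaryEntropy (Set.Icc (1 / 2) 1) := by
  intro p hp q hq hpq
  rw [one_div] at hp hq
  simp only [binaryEntropy_eq_binEntropy_div]
  exact div_le_div_of_nonneg_right (Real.binEntropy_strictAntiOn.antitoneOn hp hq hpq)
    (Real.log_pos one_lt_two).le

theorem shannonEntropy_eq_sum_negMulLog {X : Type*} [Fintype X] (p : X → ℝ) :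
    shannonEntropy p = (∑ x, Real.negMulLog (p x)) / Real.log 2 := by
  simp only [shannonEntropy, Finset.sum_div, ← Finset.sum_neg_distrib, Real.negMulLog, Real.logb,
    mul_div_assoc, neg_mul, neg_div]

theorem shannonEntropy_fin_two {p : Fin 2 → ℝ} (hp : ∑ x, p x = 1) :
    shannonEntropy p = binaryEntropy (p 0) := by
  rw [Fin.sum_univ_two] at hp
  rw [shannonEntropy, Fin.sum_univ_two, binaryEntropy, ← hp, add_sub_cancel_left]

section ClassicalChannels

variable {X Y : Type*} [Fintype X] {W : X → Y → ℝ} {p : X → ℝ}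

/-- The distribution of the output of the channel `W` when the input has distribution `p`. -/
def outputDistribution (W : X → Y → ℝ) (p : X → ℝ) (y : Y) : ℝ := ∑ x, p x * W x y

theorem mul_le_outputDistribution (hp : p ∈ stdSimplex ℝ X) {y : Y} (hW : ∀ x, 0 ≤ W x y) (x : X) :
    p x * W x y ≤ outputDistribution W p y :=
  Finset.single_le_sum (f := fun x => p x * W x y) (fun x _ => mul_nonneg (hp.1 x) (hW x))
    (Finset.mem_univ x)

/-- The information density `log₂ (W(y|x) / r(y))`, where `r` is the output distribution; it has
the junk value `0` at pairs with `W x y = 0`, which do not occur. -/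
noncomputable def informationDensity (W : X → Y → ℝ) (p : X → ℝ) (x : X) (y : Y) : ℝ :=
  Real.logb 2 (W x y / outputDistribution W p y)

theorem mul_informationDensity (hp : p ∈ stdSimplex ℝ X) {y : Y} (hW : ∀ x, 0 ≤ W x y) (x : X) :
    p x * W x y * informationDensity W p x y = p x * W x y * Real.logb 2 (W x y)
      - p x * W x y * Real.logb 2 (outputDistribution W p y) := by
  rcases (mul_nonneg (hp.1 x) (hW x)).eq_or_lt with h | h
  · simp [← h]
  · have hr : outputDistribution W p y ≠ 0 := (h.trans_le (mul_le_outputDistribution hp hW x)).ne'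
    rw [informationDensity, Real.logb_div (right_ne_zero_of_mul h.ne') hr, mul_sub]

variable [Fintype Y]

theorem sum_outputDistribution (hp : ∑ x, p x = 1) (hW : ∀ x, ∑ y, W x y = 1) :
    ∑ y, outputDistribution W p y = 1 := by
  simp only [outputDistribution]
  rw [Finset.sum_comm]
  simp only [← Finset.mul_sum, hW, mul_one, hp]

theorem outputDistribution_mem_stdSimplex (hp : p ∈ stdSimplex ℝ X)
    (hW : ∀ x, W x ∈ stdSimplex ℝ Y) : outputDistribution W p ∈ stdSimplex ℝ Y :=
  ⟨fun y => Finset.sum_nonneg fun x _ => mul_nonneg (hp.1 x) ((hW x).1 y),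
    sum_outputDistribution hp.2 fun x => (hW x).2⟩

theorem jointDistribution_mem_stdSimplex (hp : p ∈ stdSimplex ℝ X)
    (hW : ∀ x, W x ∈ stdSimplex ℝ Y) :
    (fun z : X × Y => p z.1 * W z.1 z.2) ∈ stdSimplex ℝ (X × Y) := by
  refine ⟨fun z => mul_nonneg (hp.1 _) ((hW _).1 _), ?_⟩
  simp only [Fintype.sum_prod_type, ← Finset.mul_sum, (hW _).2, mul_one, hp.2]

theorem mutualInformation_eq_shannonEntropy_sub (hW : ∀ x, ∑ y, W x y = 1) (p : X → ℝ) :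
    mutualInformation W p
      = shannonEntropy (outputDistribution W p) - ∑ x, p x * shannonEntropy (W x) := by
  have hjoint : shannonEntropy (fun z : X × Y => p z.1 * W z.1 z.2)
      = shannonEntropy p + ∑ x, p x * shannonEntropy (W x) := by
    simp only [shannonEntropy_eq_sum_negMulLog, Fintype.sum_prod_type, Real.negMulLog_mul,
      Finset.sum_add_distrib, ← Finset.sum_mul, ← Finset.mul_sum, hW, one_mul, add_div,
      Finset.sum_div, mul_div_assoc]
  rw [mutualInformation, hjoint, add_sub_add_left_eq_sub]
  rfl

theorem mutualInformation_eq_sum_informationDensity (hp : p ∈ stdSimplex ℝ X)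
    (hW : ∀ x, W x ∈ stdSimplex ℝ Y) :
    mutualInformation W p = ∑ x, ∑ y, p x * W x y * informationDensity W p x y := by
  have hout : shannonEntropy (outputDistribution W p)
      = -∑ x, ∑ y, p x * W x y * Real.logb 2 (outputDistribution W p y) := by
    rw [shannonEntropy, Finset.sum_comm]
    simp only [← Finset.sum_mul]
    rfl
  rw [mutualInformation_eq_shannonEntropy_sub (fun x => (hW x).2), hout]
  simp only [mul_informationDensity hp fun x => (hW x).1 _, Finset.sum_sub_distrib, shannonEntropy,
    mul_neg, Finset.sum_neg_distrib, Finset.mul_sum, mul_assoc]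
  ring

theorem mutualInformation_nonneg (hp : p ∈ stdSimplex ℝ X) (hW : ∀ x, W x ∈ stdSimplex ℝ Y) :
    0 ≤ mutualInformation W p := by
  have hr := outputDistribution_mem_stdSimplex hp hW
  have hterm (x : X) (y : Y) : (p x * W x y - p x * outputDistribution W p y) / Real.log 2
      ≤ p x * W x y * informationDensity W p x y := by
    have hW0 (x) : 0 ≤ W x y := (hW x).1 y
    rcases (mul_nonneg (hp.1 x) (hW0 x)).eq_or_lt with h | h
    · rw [← h, zero_mul, zero_sub]
      exact div_nonpos_of_nonpos_of_nonneg (neg_nonpos.2 (mul_nonneg (hp.1 x) (hr.1 y)))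
        (Real.log_pos one_lt_two).le
    · have hWpos := (hW0 x).lt_of_ne' (right_ne_zero_of_mul h.ne')
      have hrpos := h.trans_le (mul_le_outputDistribution hp hW0 x)
      have hlog := Real.one_sub_inv_le_log_of_pos (div_pos hWpos hrpos)
      rw [informationDensity, Real.logb, ← mul_div_assoc]
      refine div_le_div_of_nonneg_right ?_ (Real.log_pos one_lt_two).le
      refine le_trans (le_of_eq ?_) (mul_le_mul_of_nonneg_left hlog h.le)
      field_simp
  rw [mutualInformation_eq_sum_informationDensity hp hW]
  calc (0 : ℝ)
      = ∑ x, ∑ y, (p x * W x y - p x * outputDistribution W p y) / Real.log 2 := by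
        simp only [← Finset.sum_div, Finset.sum_sub_distrib, ← Finset.mul_sum, (hW _).2, hr.2,
          sub_self, zero_div, Finset.sum_const_zero]
    _ ≤ ∑ x, ∑ y, p x * W x y * informationDensity W p x y :=
        Finset.sum_le_sum fun x _ => Finset.sum_le_sum fun y _ => hterm x y

/-- The variance of the information density, which governs the speed of convergence in the coding
theorem. -/
noncomputable def informationVariance (W : X → Y → ℝ) (p : X → ℝ) : ℝ :=
  ∑ x, ∑ y, p x * W x y * (informationDensity W p x y - mutualInformation W p) ^ 2

end ClassicalChannels

section BSC

variable {q : ℝ}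

theorem sum_bsc (q : ℝ) (x : Fin 2) : ∑ y, bsc q x y = 1 := by
  fin_cases x <;> simp [bsc]

theorem bsc_mem_stdSimplex (hq : q ∈ Set.Icc 0 1) (x : Fin 2) : bsc q x ∈ stdSimplex ℝ (Fin 2) := by
  have h0 := hq.1
  have h1 := sub_nonneg.2 hq.2
  refine ⟨fun y => ?_, ?_⟩
  · rw [bsc]
    split_ifs <;> assumption
  · exact sum_bsc q x

theorem shannonEntropy_bsc (q : ℝ) (x : Fin 2) : shannonEntropy (bsc q x) = binaryEntropy q := by
  fin_cases x <;> simp [shannonEntropy, bsc, binaryEntropy, add_comm]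

theorem mutualInformation_bsc (q : ℝ) {p : Fin 2 → ℝ} (hp : ∑ x, p x = 1) :
    mutualInformation (bsc q) p
      = binaryEntropy (outputDistribution (bsc q) p 0) - binaryEntropy q := by
  rw [mutualInformation_eq_shannonEntropy_sub (sum_bsc q),
    shannonEntropy_fin_two (sum_outputDistribution hp (sum_bsc q))]
  simp only [shannonEntropy_bsc, ← Finset.sum_mul, hp, one_mul]

theorem half_mem_stdSimplex : (fun _ => 1 / 2) ∈ stdSimplex ℝ (Fin 2) :=
  ⟨fun _ => by norm_num, by norm_num⟩

theorem mutualInformation_bsc_half (q : ℝ) :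
    mutualInformation (bsc q) (fun _ => 1 / 2) = 1 - binaryEntropy q := by
  have hout : outputDistribution (bsc q) (fun _ => 1 / 2) 0 = 1 / 2 := by
    simp only [outputDistribution, bsc, Fin.sum_univ_two, if_true, one_ne_zero, if_false]
    ring
  rw [mutualInformation_bsc q half_mem_stdSimplex.2, hout, binaryEntropy_half]

theorem isGreatest_mutualInformations_bsc (q : ℝ) :
    IsGreatest (mutualInformations (bsc q)) (1 - binaryEntropy q) := by
  refine ⟨⟨_, half_mem_stdSimplex, mutualInformation_bsc_half q⟩, ?_⟩
  rintro _ ⟨p, hp, rfl⟩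
  rw [mutualInformation_bsc q hp.2]
  exact sub_le_sub_right (binaryEntropy_le_one _) _

theorem shannonCapacity_bsc (q : ℝ) : shannonCapacity (bsc q) = 1 - binaryEntropy q :=
  (isGreatest_mutualInformations_bsc q).csSup_eq

end BSC

/-! ### The coding theorem for memoryless channels -/

section ProductDistributions

open MeasureTheory ProbabilityTheory

variable {ι α : Type*} [Fintype ι] [Fintype α] {w : ι → α → ℝ}

theorem prod_mem_stdSimplex [DecidableEq ι] (hw : ∀ i, w i ∈ stdSimplex ℝ α) :
    (fun y : ι → α => ∏ i, w i (y i)) ∈ stdSimplex ℝ (ι → α) := by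
  refine ⟨fun y => Finset.prod_nonneg fun i _ => (hw i).1 _, ?_⟩
  rw [← Fintype.piFinset_univ, ← Finset.prod_univ_sum]
  exact Finset.prod_eq_one fun i _ => (hw i).2

theorem exists_isProbabilityMeasure_real_singleton [MeasurableSpace α] [MeasurableSingletonClass α]
    {p : α → ℝ} (hp : p ∈ stdSimplex ℝ α) :
    ∃ μ : Measure α, IsProbabilityMeasure μ ∧ ∀ a, μ.real {a} = p a := by
  refine ⟨(PMF.ofFintype (fun a => ENNReal.ofReal (p a)) ?_).toMeasure, inferInstance, fun a => ?_⟩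
  · rw [← ENNReal.ofReal_sum_of_nonneg fun a _ => hp.1 a, hp.2, ENNReal.ofReal_one]
  · rw [measureReal_def, PMF.toMeasure_apply_singleton _ _ (measurableSet_singleton a),
      PMF.ofFintype_apply, ENNReal.toReal_ofReal (hp.1 a)]

theorem sum_prod_filter_sum_le_le [DecidableEq ι] (hw : ∀ i, w i ∈ stdSimplex ℝ α) (f : ι → α → ℝ)
    {t : ℝ} (ht : 0 < t) :
    ∑ y : ι → α with ∑ i, f i (y i) ≤ ∑ i, ∑ a, w i a * f i a - t, ∏ i, w i (y i)
      ≤ (∑ i, ∑ a, w i a * (f i a - ∑ b, w i b * f i b) ^ 2) / t ^ 2 := by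
  let _ : MeasurableSpace α := ⊤
  choose μ hμ hμw using fun i => exists_isProbabilityMeasure_real_singleton (hw i)
  have hmean (i) (g : α → ℝ) : ∫ a, g a ∂μ i = ∑ a, w i a * g a := by
    simp [integral_fintype Integrable.of_finite, hμw]
  set X : (ι → α) → ℝ := ∑ i, fun y => f i (y i)
  have hX : (Measure.pi μ)[X] = ∑ i, ∑ a, w i a * f i a := by
    simp only [X, Finset.sum_apply, ← hmean]
    rw [integral_finsetSum _ fun i _ => Integrable.of_finite]
    exact Finset.sum_congr rfl fun i _ =>
      integral_comp_eval Measurable.of_discrete.aestronglyMeasurable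
  have hvar : Var[X; Measure.pi μ] = ∑ i, ∑ a, w i a * (f i a - ∑ b, w i b * f i b) ^ 2 := by
    rw [variance_sum_pi fun i => MemLp.of_discrete]
    simp only [variance_eq_integral Measurable.of_discrete.aemeasurable, hmean]
  have hcheb := meas_ge_le_variance_div_sq (μ := Measure.pi μ) (X := X) MemLp.of_discrete ht
  have hmass (y : ι → α) : ∏ i, w i (y i) = (Measure.pi μ).real {y} := by
    simp only [measureReal_def, Measure.pi_singleton, ENNReal.toReal_prod, ← hμw]
  rw [← hX, ← hvar, Finset.sum_congr rfl fun y _ => hmass y, sum_measureReal_singleton]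
  refine ENNReal.toReal_le_of_le_ofReal (div_nonneg (variance_nonneg X _) (sq_nonneg t))
    ((measure_mono fun y hy => ?_).trans hcheb)
  have hy' : ∑ i, f i (y i) ≤ (Measure.pi μ)[X] - t := by simpa using hy
  have hXy : X y = ∑ i, f i (y i) := Finset.sum_apply y _ _
  rw [Set.mem_ofPred_eq, hXy]
  exact le_abs.2 (Or.inr (by linarith))

end ProductDistributions

section Coding

section Feinstein

variable {X Y : Type*} [Fintype X] [Fintype Y] {W : X → Y → ℝ} {p : X → ℝ}

theorem exists_one_sub_le_sum_sdiff [DecidableEq Y] (hp : p ∈ stdSimplex ℝ X)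
    (hW : ∀ x, W x ∈ stdSimplex ℝ Y) {B : X → Finset Y} {U : Finset Y} {ε : ℝ}
    (h : ∑ x, p x * ∑ y ∈ (B x)ᶜ, W x y + ∑ y ∈ U, outputDistribution W p y ≤ ε) :
    ∃ x, 1 - ε ≤ ∑ y ∈ B x \ U, W x y := by
  by_contra! hlt
  have hcover (x : X) : 1 ≤ ∑ y ∈ B x \ U, W x y + ∑ y ∈ (B x)ᶜ, W x y + ∑ y ∈ U, W x y := by
    have hU : ∑ y ∈ B x ∩ U, W x y ≤ ∑ y ∈ U, W x y :=
      Finset.sum_le_sum_of_subset_of_nonneg Finset.inter_subset_right fun y _ _ => (hW x).1 y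
    linarith [(hW x).2, Finset.sum_add_sum_compl (B x) (W x),
      Finset.sum_inter_add_sum_sdiff (B x) U (W x)]
  have hU : ∑ y ∈ U, outputDistribution W p y = ∑ x, p x * ∑ y ∈ U, W x y := by
    simp only [outputDistribution, Finset.mul_sum]
    exact Finset.sum_comm
  have hmass : ∑ x, p x * (ε - ∑ y ∈ (B x)ᶜ, W x y - ∑ y ∈ U, W x y)
      = ε - ∑ x, p x * ∑ y ∈ (B x)ᶜ, W x y - ∑ y ∈ U, outputDistribution W p y := by
    simp only [mul_sub, Finset.sum_sub_distrib, ← Finset.sum_mul, hp.2, one_mul, hU]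
  obtain ⟨x, -, hx⟩ : ∃ x ∈ Finset.univ, 0 < p x :=
    Finset.exists_lt_of_sum_lt (by simp [hp.2])
  have hneg : ∑ x, p x * (ε - ∑ y ∈ (B x)ᶜ, W x y - ∑ y ∈ U, W x y) < 0 :=
    Finset.sum_neg' (fun x _ => mul_nonpos_of_nonneg_of_nonpos (hp.1 x)
      (by linarith [hlt x, hcover x])) ⟨x, Finset.mem_univ x, mul_neg_of_pos_of_neg hx
      (by linarith [hlt x, hcover x])⟩
  linarith

theorem mul_sum_outputDistribution_le_one {x : X} (hx : W x ∈ stdSimplex ℝ Y) {s : ℝ}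
    {D : Finset Y} (hD : ∀ y ∈ D, s * outputDistribution W p y ≤ W x y) :
    s * ∑ y ∈ D, outputDistribution W p y ≤ 1 := by
  rw [Finset.mul_sum]
  exact (Finset.sum_le_sum hD).trans
    (hx.2 ▸ Finset.sum_le_univ_sum_of_nonneg hx.1)

/-- Feinstein's lemma. Each decoding set has output probability at most `1 / s`, so as long as at
most `s * (ε - δ)` of them are in use, an average input still has error at most `ε` when it is
decoded outside of them. -/
theorem exists_decodingSets (hp : p ∈ stdSimplex ℝ X) (hW : ∀ x, W x ∈ stdSimplex ℝ Y)
    {s δ ε : ℝ} (hs : 0 < s)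
    (hδ : ∑ x, p x * ∑ y with W x y < s * outputDistribution W p y, W x y ≤ δ) (K : ℕ)
    (hK : K ≤ s * (ε - δ) + 1) :
    ∃ (x : Fin K → X) (D : Fin K → Finset Y), Pairwise (fun i j => Disjoint (D i) (D j)) ∧
      (∀ i, ∀ y ∈ D i, s * outputDistribution W p y ≤ W (x i) y) ∧
      ∀ i, 1 - ε ≤ ∑ y ∈ D i, W (x i) y := by
  classical
  induction K with
  | zero => exact ⟨Fin.elim0, Fin.elim0, fun i => i.elim0, fun i => i.elim0, fun i => i.elim0⟩
  | succ K ih =>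
    push_cast at hK
    obtain ⟨x, D, hdisj, htyp, herr⟩ := ih (by linarith)
    have hU : ∑ y ∈ Finset.univ.biUnion D, outputDistribution W p y ≤ ε - δ := by
      refine le_of_mul_le_mul_left ?_ hs
      calc s * ∑ y ∈ Finset.univ.biUnion D, outputDistribution W p y
          = ∑ i, s * ∑ y ∈ D i, outputDistribution W p y := by
            rw [Finset.sum_biUnion fun i _ j _ hij => hdisj hij, Finset.mul_sum]
        _ ≤ ∑ _i : Fin K, 1 := Finset.sum_le_sum fun i _ =>
            mul_sum_outputDistribution_le_one (hW (x i)) (htyp i)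
        _ ≤ s * (ε - δ) := by
            simp only [Finset.sum_const, Finset.card_univ, Fintype.card_fin, nsmul_one]
            linarith
    obtain ⟨z, hz⟩ := exists_one_sub_le_sum_sdiff hp hW
      (B := fun x => {y | s * outputDistribution W p y ≤ W x y}) (U := Finset.univ.biUnion D)
      (ε := ε) (by simp only [Finset.compl_filter, not_le]; linarith)
    have hnew (i : Fin K) : Disjoint
        (({y | s * outputDistribution W p y ≤ W z y} : Finset Y) \ Finset.univ.biUnion D) (D i) :=
      Finset.sdiff_disjoint.mono_right (Finset.subset_biUnion_of_mem D (Finset.mem_univ i))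
    refine ⟨Fin.cons z x, Fin.cons _ D, pairwise_fin_succ_iff.2
      ⟨fun i => (hnew i).symm, fun i => hnew i, hdisj⟩, Fin.cases (fun y hy => ?_) htyp,
      Fin.cases hz herr⟩
    simpa using (Finset.mem_sdiff.1 hy).1

end Feinstein

theorem exists_decoder {ι Y : Type*} [Nonempty ι] {D : ι → Finset Y}
    (hD : Pairwise fun i j => Disjoint (D i) (D j)) : ∃ g : Y → ι, ∀ i, ∀ y ∈ D i, g y = i := by
  have h (y : Y) : ∃ j, ∀ i, y ∈ D i → j = i := by
    by_cases hy : ∃ j, y ∈ D j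
    · obtain ⟨j, hj⟩ := hy
      exact ⟨j, fun i hi => hD.eq (Finset.not_disjoint_iff.2 ⟨y, hj, hi⟩)⟩
    · exact ⟨Classical.arbitrary ι, fun i hi => absurd ⟨i, hi⟩ hy⟩
  choose g hg using h
  exact ⟨g, fun i y => hg y i⟩

theorem exists_blockCode_of_decodingSets {n K : ℕ} [NeZero K]
    {V : (Fin n → Fin 2) → (Fin n → Fin 2) → ℝ} (hV : ∀ x, V x ∈ stdSimplex ℝ (Fin n → Fin 2))
    {ε : ℝ} (x : Fin K → Fin n → Fin 2) {D : Fin K → Finset (Fin n → Fin 2)}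
    (hD : Pairwise fun i j => Disjoint (D i) (D j)) (herr : ∀ i, 1 - ε ≤ ∑ y ∈ D i, V (x i) y) :
    ∃ c : BlockCode n, c.size = K ∧ ∀ m, errorProb V c m ≤ ε := by
  obtain ⟨g, hg⟩ := exists_decoder hD
  refine ⟨⟨K, x, g⟩, rfl, fun m => ?_⟩
  have hcompl : errorProb V ⟨K, x, g⟩ m ≤ ∑ y ∈ (D m)ᶜ, V (x m) y := by
    rw [errorProb, ← Finset.sum_add_sum_compl (D m),
      Finset.sum_eq_zero fun y hy => if_pos (hg m y hy), zero_add]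
    refine Finset.sum_le_sum fun y _ => ?_
    split_ifs
    exacts [(hV _).1 y, le_rfl]
  linarith [herr m, (hV (x m)).2, Finset.sum_add_sum_compl (D m) (V (x m))]

theorem errorProb_nonneg {n : ℕ} {V : (Fin n → Fin 2) → (Fin n → Fin 2) → ℝ}
    (hV : ∀ x y, 0 ≤ V x y) (c : BlockCode n) (m : Fin c.size) : 0 ≤ errorProb V c m :=
  Finset.sum_nonneg fun y _ => by
    split_ifs
    exacts [le_rfl, hV _ y]

section Memoryless

variable {W : Fin 2 → Fin 2 → ℝ} {p : Fin 2 → ℝ}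

theorem memoryless_mem_stdSimplex (hW : ∀ x, W x ∈ stdSimplex ℝ (Fin 2)) (n : ℕ)
    (x : Fin n → Fin 2) : memoryless W n x ∈ stdSimplex ℝ (Fin n → Fin 2) :=
  prod_mem_stdSimplex fun i => hW (x i)

theorem outputDistribution_memoryless (W : Fin 2 → Fin 2 → ℝ) (p : Fin 2 → ℝ) (n : ℕ)
    (y : Fin n → Fin 2) :
    outputDistribution (memoryless W n) (fun x => ∏ i, p (x i)) y
      = ∏ i, outputDistribution W p (y i) := by
  simp only [outputDistribution, memoryless, Finset.prod_univ_sum, Fintype.piFinset_univ,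
    Finset.prod_mul_distrib]

theorem informationDensity_memoryless {n : ℕ} {x y : Fin n → Fin 2} (hW : ∀ i, W (x i) (y i) ≠ 0)
    (hr : ∀ i, outputDistribution W p (y i) ≠ 0) :
    informationDensity (memoryless W n) (fun x => ∏ i, p (x i)) x y
      = ∑ i, informationDensity W p (x i) (y i) := by
  simp only [informationDensity]
  rw [outputDistribution_memoryless, memoryless, ← Finset.prod_div_distrib,
    Real.logb_prod _ _ fun i _ => div_ne_zero (hW i) (hr i)]

theorem sum_informationDensity_le_of_memoryless_lt (hp : p ∈ stdSimplex ℝ (Fin 2))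
    (hW : ∀ x, W x ∈ stdSimplex ℝ (Fin 2)) {n : ℕ} {x y : Fin n → Fin 2}
    (hxy : ∏ i, p (x i) * W (x i) (y i) ≠ 0) {a : ℝ}
    (h : memoryless W n x y
      < 2 ^ a * outputDistribution (memoryless W n) (fun x => ∏ i, p (x i)) y) :
    ∑ i, informationDensity W p (x i) (y i) ≤ a := by
  have hpos (i) : 0 < p (x i) * W (x i) (y i) := (mul_nonneg (hp.1 _) ((hW _).1 _)).lt_of_ne'
    (Finset.prod_ne_zero_iff.1 hxy i (Finset.mem_univ i))
  have hr (i) : 0 < outputDistribution W p (y i) :=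
    (hpos i).trans_le (mul_le_outputDistribution hp (fun x => (hW x).1 _) _)
  have hWne (i) : W (x i) (y i) ≠ 0 := right_ne_zero_of_mul (hpos i).ne'
  rw [← informationDensity_memoryless hWne fun i => (hr i).ne', informationDensity,
    Real.logb_le_iff_le_rpow one_lt_two, div_le_iff₀]
  · exact h.le
  · rw [outputDistribution_memoryless]
    exact Finset.prod_pos fun i _ => hr i
  · rw [outputDistribution_memoryless, memoryless]
    exact div_pos (Finset.prod_pos fun i _ => ((hW _).1 _).lt_of_ne' (hWne i))
      (Finset.prod_pos fun i _ => hr i)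

theorem sum_memoryless_atypical_le (hp : p ∈ stdSimplex ℝ (Fin 2))
    (hW : ∀ x, W x ∈ stdSimplex ℝ (Fin 2)) (n : ℕ) {t : ℝ} (ht : 0 < t) :
    ∑ x, (∏ i, p (x i)) * ∑ y with memoryless W n x y
        < 2 ^ (n * mutualInformation W p - t)
          * outputDistribution (memoryless W n) (fun x => ∏ i, p (x i)) y, memoryless W n x y
      ≤ n * informationVariance W p / t ^ 2 := by
  have hmean : ∑ z : Fin 2 × Fin 2, p z.1 * W z.1 z.2 * informationDensity W p z.1 z.2
      = mutualInformation W p := by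
    rw [mutualInformation_eq_sum_informationDensity hp hW, Fintype.sum_prod_type]
  have hvar : ∑ z : Fin 2 × Fin 2, p z.1 * W z.1 z.2 *
      (informationDensity W p z.1 z.2 - mutualInformation W p) ^ 2 = informationVariance W p :=
    Fintype.sum_prod_type _
  have hcheb := sum_prod_filter_sum_le_le
    (fun _ : Fin n => jointDistribution_mem_stdSimplex hp hW)
    (fun _ z => informationDensity W p z.1 z.2) ht
  simp only [hmean, hvar, Finset.sum_const, Finset.card_univ, Fintype.card_fin,
    nsmul_eq_mul] at hcheb
  refine le_trans ?_ hcheb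
  rw [Finset.sum_filter, ← (Equiv.arrowProdEquivProdArrow (Fin n) _ _).symm.sum_comp,
    Fintype.sum_prod_type]
  refine Finset.sum_le_sum fun x _ => ?_
  rw [Finset.mul_sum, Finset.sum_filter]
  refine Finset.sum_le_sum fun y _ => ?_
  have hjoint : (∏ i, p (x i)) * memoryless W n x y = ∏ i, p (x i) * W (x i) (y i) :=
    Finset.prod_mul_distrib.symm
  have hnonneg : 0 ≤ ∏ i, p (x i) * W (x i) (y i) :=
    Finset.prod_nonneg fun i _ => mul_nonneg (hp.1 _) ((hW _).1 _)
  simp only [Equiv.arrowProdEquivProdArrow_symm_apply, hjoint]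
  split_ifs with hatyp hle
  · exact le_rfl
  · exact (not_imp_comm.1
      (fun hne => sum_informationDensity_le_of_memoryless_lt hp hW hne hatyp) hle).le
  · exact hnonneg
  · exact le_rfl

theorem exists_blockCode_memoryless (hp : p ∈ stdSimplex ℝ (Fin 2))
    (hW : ∀ x, W x ∈ stdSimplex ℝ (Fin 2)) (n : ℕ) {t : ℝ} (ht : 0 < t) :
    ∃ c : BlockCode n, c.size = ⌊(2 : ℝ) ^ (n * mutualInformation W p - 2 * t)⌋₊ + 1 ∧
      ∀ m, errorProb (memoryless W n) c m
        ≤ n * informationVariance W p / t ^ 2 + 2 ^ (-t) := by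
  obtain ⟨x, D, hD, -, herr⟩ := exists_decodingSets
    (prod_mem_stdSimplex fun _ : Fin n => hp) (memoryless_mem_stdSimplex hW n)
    (ε := n * informationVariance W p / t ^ 2 + 2 ^ (-t)) (Real.rpow_pos_of_pos two_pos _)
    (sum_memoryless_atypical_le hp hW n ht)
    (⌊(2 : ℝ) ^ (n * mutualInformation W p - 2 * t)⌋₊ + 1) (by
      rw [add_sub_cancel_left, ← Real.rpow_add two_pos, sub_add, sub_neg_eq_add, ← two_mul]
      push_cast
      gcongr
      exact Nat.floor_le (Real.rpow_nonneg two_pos.le _))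
  exact exists_blockCode_of_decodingSets (memoryless_mem_stdSimplex hW n) x hD herr

open Filter Topology

theorem tendsto_logb_floor_rpow_div {C : ℝ} (hC : 0 ≤ C) {u : ℕ → ℝ} (hu : ∀ n, 0 ≤ u n)
    (hu' : Tendsto (fun n => u n / n) atTop (𝓝 0)) :
    Tendsto (fun n : ℕ => Real.logb 2 ((⌊(2 : ℝ) ^ (n * C - u n)⌋₊ + 1 : ℕ) : ℝ) / n)
      atTop (𝓝 C) := by
  have hlower : Tendsto (fun n : ℕ => C - u n / n) atTop (𝓝 C) := by
    simpa using tendsto_const_nhds.sub hu'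
  have hupper : Tendsto (fun n : ℕ => C + 1 / (n : ℝ)) atTop (𝓝 C) := by
    simpa using tendsto_const_nhds.add (tendsto_one_div_atTop_nhds_zero_nat (𝕜 := ℝ))
  refine tendsto_of_tendsto_of_tendsto_of_le_of_le' hlower hupper ?_ ?_ <;>
    filter_upwards [eventually_gt_atTop 0] with n hn
  · have hn' : (0 : ℝ) < n := Nat.cast_pos.2 hn
    rw [le_div_iff₀ hn', sub_mul, div_mul_cancel₀ _ hn'.ne', mul_comm C,
      Real.le_logb_iff_rpow_le one_lt_two (by positivity)]
    push_cast
    exact (Nat.lt_floor_add_one _).le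
  · have hn' : (0 : ℝ) < n := Nat.cast_pos.2 hn
    have hfloor : (⌊(2 : ℝ) ^ (n * C - u n)⌋₊ : ℝ) ≤ 2 ^ (n * C) :=
      (Nat.floor_le (Real.rpow_nonneg two_pos.le _)).trans
        (Real.rpow_le_rpow_of_exponent_le one_le_two (sub_le_self _ (hu n)))
    have hone : (1 : ℝ) ≤ 2 ^ (n * C) := Real.one_le_rpow one_le_two (by positivity)
    rw [div_le_iff₀ hn', add_mul, div_mul_cancel₀ _ hn'.ne', mul_comm C,
      Real.logb_le_iff_le_rpow one_lt_two (by positivity), Real.rpow_add two_pos, Real.rpow_one]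
    push_cast
    linarith

theorem tendsto_rpow_add_one_div :
    Tendsto (fun n : ℕ => ((n : ℝ) ^ (3 / 4 : ℝ) + 1) / n) atTop (𝓝 0) := by
  have hpow : Tendsto (fun n : ℕ => (n : ℝ) ^ (-(1 / 4) : ℝ)) atTop (𝓝 0) :=
    (tendsto_rpow_neg_atTop (by norm_num)).comp tendsto_natCast_atTop_atTop
  have hsum := hpow.add (tendsto_one_div_atTop_nhds_zero_nat (𝕜 := ℝ))
  rw [add_zero] at hsum
  refine hsum.congr' ?_
  filter_upwards [eventually_gt_atTop 0] with n hn
  rw [add_div, ← Real.rpow_sub_one (Nat.cast_ne_zero.2 hn.ne')]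
  norm_num

theorem tendsto_div_rpow_add_one_sq :
    Tendsto (fun n : ℕ => n / ((n : ℝ) ^ (3 / 4 : ℝ) + 1) ^ 2) atTop (𝓝 0) := by
  have hpow : Tendsto (fun n : ℕ => (n : ℝ) ^ (-(1 / 2) : ℝ)) atTop (𝓝 0) :=
    (tendsto_rpow_neg_atTop (by norm_num)).comp tendsto_natCast_atTop_atTop
  refine squeeze_zero' (.of_forall fun n => by positivity) ?_ hpow
  filter_upwards [eventually_gt_atTop 0] with n hn
  have hn' : (0 : ℝ) < n := Nat.cast_pos.2 hn
  rw [div_le_iff₀ (by positivity)]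
  calc (n : ℝ) = (n : ℝ) ^ (-(1 / 2) : ℝ) * ((n : ℝ) ^ (3 / 4 : ℝ)) ^ 2 := by
        rw [← Real.rpow_mul_natCast hn'.le, ← Real.rpow_add hn']
        norm_num
    _ ≤ (n : ℝ) ^ (-(1 / 2) : ℝ) * ((n : ℝ) ^ (3 / 4 : ℝ) + 1) ^ 2 := by
        gcongr
        exact le_add_of_nonneg_right zero_le_one

theorem exists_achievesRate (hp : p ∈ stdSimplex ℝ (Fin 2)) (hW : ∀ x, W x ∈ stdSimplex ℝ (Fin 2)) :
    ∃ c : (n : ℕ) → BlockCode n, AchievesRate (memoryless W) c (mutualInformation W p) := by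
  let t (n : ℕ) : ℝ := (n : ℝ) ^ (3 / 4 : ℝ) + 1
  have ht (n) : 0 < t n := by positivity
  have htop : Tendsto t atTop atTop := tendsto_atTop_add_const_right _ _
    ((tendsto_rpow_atTop (by norm_num)).comp tendsto_natCast_atTop_atTop)
  choose c hsize herr using fun n => exists_blockCode_memoryless hp hW n (ht n)
  have hbound : Tendsto (fun n : ℕ => n * informationVariance W p / t n ^ 2 + 2 ^ (-t n))
      atTop (𝓝 0) := by
    have hvar := tendsto_div_rpow_add_one_sq.mul_const (informationVariance W p)
    have hexp : Tendsto (fun n => (2 : ℝ) ^ (-t n)) atTop (𝓝 0) :=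
      (tendsto_rpow_atBot_of_base_gt_one 2 one_lt_two).comp (tendsto_neg_atTop_atBot.comp htop)
    simpa [div_mul_eq_mul_div, t] using hvar.add hexp
  have hrow (n) (x) := (memoryless_mem_stdSimplex hW n x).1
  refine ⟨c, ?_, squeeze_zero (fun n => Real.iSup_nonneg fun m => errorProb_nonneg (hrow n) _ m)
    (fun n => ?_) hbound⟩
  · simp only [hsize]
    refine tendsto_logb_floor_rpow_div (mutualInformation_nonneg hp hW)
      (fun n => (mul_pos two_pos (ht n)).le) ?_
    simpa [mul_div_assoc] using tendsto_rpow_add_one_div.const_mul 2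
  · have : Nonempty (Fin (c n).size) := ⟨⟨0, by rw [hsize]; exact Nat.succ_pos _⟩⟩
    exact ciSup_le (herr n)

theorem exists_achievesRate_shannonCapacity_bsc {q : ℝ} (hq : q ∈ Set.Icc 0 1) :
    ∃ c : (n : ℕ) → BlockCode n,
      AchievesRate (memoryless (bsc q)) c (shannonCapacity (bsc q)) := by
  rw [shannonCapacity_bsc, ← mutualInformation_bsc_half]
  exact exists_achievesRate half_mem_stdSimplex (bsc_mem_stdSimplex hq)

end Memoryless

end Coding

/-! ### Spectra and entropies of qubit states -/

section Matrices

open scoped Matrix.Norms.L2Operator MatrixOrder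

variable {n : Type*} [Fintype n] {A B : Matrix n n ℂ}

theorem mul_eq_zero_of_trace_mul_eq_zero (hA : A.PosSemidef) (hB : B.PosSemidef)
    (h : (A * B).trace = 0) : A * B = 0 := by
  classical
  obtain ⟨C, rfl⟩ := CStarAlgebra.nonneg_iff_eq_star_mul_self.1 hA.nonneg
  obtain ⟨D, rfl⟩ := CStarAlgebra.nonneg_iff_eq_star_mul_self.1 hB.nonneg
  have hCD : C * star D = 0 := by
    rw [← Matrix.trace_conjTranspose_mul_self_eq_zero_iff, ← h]
    simp only [Matrix.star_eq_conjTranspose, Matrix.conjTranspose_mul,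
      Matrix.conjTranspose_conjTranspose]
    rw [Matrix.mul_assoc, Matrix.trace_mul_comm]
    simp only [Matrix.mul_assoc]
  rw [mul_assoc, ← mul_assoc C, hCD, zero_mul, mul_zero]

variable [DecidableEq n]

theorem exists_eigenvalues_eq_norm [Nonempty n] (hA : A.PosSemidef) :
    ∃ i, hA.isHermitian.eigenvalues i = ‖A‖ := by
  have hmem := CStarAlgebra.norm_mem_spectrum_of_nonneg (a := A) hA.nonneg
  rwa [hA.isHermitian.spectrum_real_eq_range_eigenvalues] at hmem

theorem posSemidef_norm_smul_one_sub (hA : A.IsHermitian) : (‖A‖ • 1 - A).PosSemidef := by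
  rw [← Algebra.algebraMap_eq_smul_one]
  exact Matrix.nonneg_iff_posSemidef.1 (sub_nonneg.2 (IsSelfAdjoint.le_algebraMap_norm_self hA))

theorem exists_isStarProjection_trace_mul_eq_eigenvalues (hA : A.IsHermitian) (i : n) :
    ∃ τ : Matrix n n ℂ, IsStarProjection τ ∧ τ.PosSemidef ∧ τ.trace = 1 ∧
      (A * τ).trace = hA.eigenvalues i := by
  set v : n → ℂ := (hA.eigenvectorBasis i).ofLp
  have hv : v ⬝ᵥ star v = 1 :=
    (EuclideanSpace.inner_eq_star_dotProduct _ _).symm.trans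
      (inner_self_eq_one_of_norm_eq_one (hA.eigenvectorBasis.norm_eq_one i))
  have hpos := Matrix.posSemidef_vecMulVec_self_star v
  have htrace : (Matrix.vecMulVec v (star v)).trace = 1 := by rw [Matrix.trace_vecMulVec, hv]
  refine ⟨Matrix.vecMulVec v (star v), ⟨?_, hpos.isHermitian⟩, hpos, htrace, ?_⟩
  · rw [IsIdempotentElem, Matrix.vecMulVec_mul_vecMulVec, dotProduct_comm, hv, one_smul]
  · rw [Matrix.mul_vecMulVec, hA.mulVec_eigenvectorBasis, Matrix.smul_vecMulVec,
      Matrix.trace_smul, htrace]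
    simp

end Matrices

theorem det_one_sub {A : Op} (h : A.trace = 1) : (1 - A).det = A.det := by
  rw [Matrix.trace_fin_two] at h
  simp only [Matrix.det_fin_two, Matrix.sub_apply, Matrix.one_apply_eq, ne_eq, zero_ne_one,
    one_ne_zero, not_false_eq_true, Matrix.one_apply_ne]
  linear_combination -h

theorem isStarProjection_of_det_eq_zero {A : Op} (hA : A.IsHermitian) (htrace : A.trace = 1)
    (hdet : A.det = 0) : IsStarProjection A := by
  have hCH := A.aeval_self_charpoly
  rw [Matrix.charpoly_fin_two, htrace, hdet] at hCH
  refine ⟨sub_eq_zero.1 ?_, hA⟩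
  simpa [sq] using hCH

namespace IsState

variable {A ρ σ τ : Op}

theorem mix (hρ : IsState ρ) (hσ : IsState σ) {p : ℝ} (hp : p ∈ Set.Icc 0 1) :
    IsState (p • ρ + (1 - p) • σ) := by
  refine ⟨(hρ.1.smul hp.1).add (hσ.1.smul (sub_nonneg.2 hp.2)), ?_⟩
  simp [Matrix.trace_add, Matrix.trace_smul, hρ.2, hσ.2]

theorem eigenvalues_add (hA : IsState A) :
    hA.1.isHermitian.eigenvalues 0 + hA.1.isHermitian.eigenvalues 1 = 1 := by
  have htrace := hA.2.symm.trans hA.1.isHermitian.trace_eq_sum_eigenvalues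
  rw [Fin.sum_univ_two] at htrace
  exact Complex.ofReal_injective (by simpa using htrace.symm)

theorem eigenvalues_eq (hA : IsState A) :
    hA.1.isHermitian.eigenvalues = ![opNorm A, 1 - opNorm A] ∨
      hA.1.isHermitian.eigenvalues = ![1 - opNorm A, opNorm A] := by
  obtain ⟨i, hi⟩ : ∃ i, hA.1.isHermitian.eigenvalues i = opNorm A :=
    exists_eigenvalues_eq_norm hA.1
  rw [← hi, ← hA.eigenvalues_add]
  fin_cases i
  · left
    ext j
    fin_cases j <;> simp
  · right
    ext j
    fin_cases j <;> simp

theorem opNorm_le_one (hA : IsState A) : opNorm A ≤ 1 := by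
  have h0 := hA.1.eigenvalues_nonneg 0
  have h1 := hA.1.eigenvalues_nonneg 1
  rcases hA.eigenvalues_eq with h | h <;> simp_all

theorem trace_opNorm_smul_one_sub (hA : IsState A) :
    (opNorm A • 1 - A).trace = (2 * opNorm A - 1 : ℝ) := by
  rw [Matrix.trace_sub, Matrix.trace_smul, Matrix.trace_one, hA.2]
  simp [mul_comm]

theorem half_le_opNorm (hA : IsState A) : 1 / 2 ≤ opNorm A := by
  have htrace : 0 ≤ (opNorm A • 1 - A).trace :=
    (posSemidef_norm_smul_one_sub hA.1.isHermitian).trace_nonneg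
  rw [hA.trace_opNorm_smul_one_sub, Complex.zero_le_real] at htrace
  linarith

theorem vonNeumannEntropy_eq (hA : IsState A) :
    vonNeumannEntropy A = binaryEntropy (opNorm A) := by
  rw [vonNeumannEntropy, dif_pos hA.1.isHermitian, binaryEntropy, Fin.sum_univ_two]
  rcases hA.eigenvalues_eq with h | h <;> simp [h, add_comm]

theorem det_eq (hA : IsState A) : A.det = (opNorm A * (1 - opNorm A) : ℝ) := by
  rw [hA.1.isHermitian.det_eq_prod_eigenvalues, Fin.prod_univ_two]
  rcases hA.eigenvalues_eq with h | h <;> simp [h, mul_comm]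

theorem one_sub (hA : IsState A) : IsState (1 - A) := by
  have hpos : (opNorm A • 1 - A).PosSemidef := posSemidef_norm_smul_one_sub hA.1.isHermitian
  refine ⟨?_, ?_⟩
  · convert (Matrix.PosSemidef.one.smul (sub_nonneg.2 hA.opNorm_le_one)).add hpos using 1
    module
  · rw [Matrix.trace_sub, Matrix.trace_one, hA.2]
    norm_num

theorem opNorm_one_sub (hA : IsState A) : opNorm (1 - A) = opNorm A := by
  have hdet := hA.one_sub.det_eq
  rw [det_one_sub hA.2, hA.det_eq, Complex.ofReal_inj] at hdet
  nlinarith [hA.half_le_opNorm, hA.one_sub.half_le_opNorm]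

theorem vonNeumannEntropy_one_sub (hA : IsState A) :
    vonNeumannEntropy (1 - A) = vonNeumannEntropy A := by
  rw [hA.vonNeumannEntropy_eq, hA.one_sub.vonNeumannEntropy_eq, hA.opNorm_one_sub]

theorem half_smul_one : IsState ((1 / 2 : ℝ) • (1 : Op)) := by
  refine ⟨Matrix.PosSemidef.one.smul (by norm_num), ?_⟩
  simp [Matrix.trace_smul]

theorem exists_isStarProjection_trace_mul_eq (hA : IsState A) :
    ∃ τ, IsState τ ∧ (A * τ).trace = (opNorm A : ℂ) ∧ IsStarProjection τ := by
  obtain ⟨i, hi⟩ : ∃ i, hA.1.isHermitian.eigenvalues i = opNorm A :=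
    exists_eigenvalues_eq_norm hA.1
  obtain ⟨τ, hproj, hpos, htrace, h⟩ :=
    exists_isStarProjection_trace_mul_eq_eigenvalues hA.1.isHermitian i
  exact ⟨τ, ⟨hpos, htrace⟩, by rw [h, hi], hproj⟩

theorem isStarProjection_of_trace_mul_eq (hA : IsState A) (hτ : IsState τ)
    (h : (A * τ).trace = (opNorm A : ℂ)) (hne : opNorm A ≠ 1 / 2) : IsStarProjection τ := by
  refine isStarProjection_of_det_eq_zero hτ.1.isHermitian hτ.2 ?_
  have hmul : (opNorm A • 1 - A) * τ = 0 := by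
    refine mul_eq_zero_of_trace_mul_eq_zero (posSemidef_norm_smul_one_sub hA.1.isHermitian) hτ.1 ?_
    simp [sub_mul, Matrix.trace_sub, Matrix.trace_smul, hτ.2, h]
  by_contra hdet
  have hscalar : opNorm A • 1 - A = 0 := by
    have hunit : IsUnit τ := (Matrix.isUnit_iff_isUnit_det τ).2 (isUnit_iff_ne_zero.2 hdet)
    exact hunit.mul_left_eq_zero.1 hmul
  have htrace := congrArg Matrix.trace hscalar
  rw [hA.trace_opNorm_smul_one_sub, Matrix.trace_zero, Complex.ofReal_eq_zero] at htrace
  exact hne (by linarith)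

end IsState

theorem vonNeumannEntropy_half_smul_one : vonNeumannEntropy ((1 / 2 : ℝ) • (1 : Op)) = 1 := by
  have hnorm : opNorm ((1 / 2 : ℝ) • (1 : Op)) = 1 / 2 := by
    rw [opNorm, ← Complex.coe_smul, map_smul, map_one, norm_smul, norm_one]
    simp
  rw [IsState.half_smul_one.vonNeumannEntropy_eq, hnorm, binaryEntropy_half]

section Compactness

open scoped Matrix.Norms.L2Operator MatrixOrder

theorem isCompact_setOf_isState : IsCompact {ρ : Op | IsState ρ} := by
  have hclosed : IsClosed {ρ : Op | IsState ρ} := by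
    simp only [IsState, ← Matrix.nonneg_iff_posSemidef]
    refine CStarAlgebra.isClosed_nonneg.inter ?_
    exact isClosed_eq continuous_id.matrix_trace continuous_const
  refine (isCompact_closedBall (0 : Op) 1).of_isClosed_subset hclosed fun ρ hρ => ?_
  exact mem_closedBall_zero_iff.2 (IsState.opNorm_le_one hρ)

theorem continuous_opNorm : Continuous opNorm := continuous_norm

end Compactness

/-! ### The scheme for a unital qubit channel -/

/-- The linear maps that send states to states, i.e. the positive trace-preserving maps. -/
def PreservesStates (Φ : Op →ₗ[ℂ] Op) : Prop := ∀ ρ, IsState ρ → IsState (Φ ρ)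

theorem IsUnitalQubitChannel.preservesStates {Φ : Op →ₗ[ℂ] Op} (hΦ : IsUnitalQubitChannel Φ) :
    PreservesStates Φ := fun ρ hρ =>
  ⟨(hΦ.completely_positive 1 _ (hρ.1.submatrix Prod.fst)).submatrix fun i => (i, 0),
    (hΦ.trace_preserving ρ).trans hρ.2⟩

section Channel

variable {Φ : Op →ₗ[ℂ] Op} {ρ τ : Op}

theorem bddAbove_outputNorms (hΦ : PreservesStates Φ) : BddAbove (outputNorms Φ) := by
  refine ⟨1, ?_⟩
  rintro _ ⟨ρ, hρ, rfl⟩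
  exact (hΦ ρ hρ).opNorm_le_one

theorem opNorm_le_maxOutputNorm (hΦ : PreservesStates Φ) (hρ : IsState ρ) :
    opNorm (Φ ρ) ≤ maxOutputNorm Φ :=
  le_csSup (bddAbove_outputNorms hΦ) ⟨ρ, hρ, rfl⟩

theorem normMaximizers_nonempty (Φ : Op →ₗ[ℂ] Op) : (normMaximizers Φ).Nonempty := by
  obtain ⟨ρ, hρ, hmax⟩ := isCompact_setOf_isState.exists_isMaxOn ⟨_, IsState.half_smul_one⟩
    (continuous_opNorm.comp Φ.continuous_of_finiteDimensional).continuousOn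
  have hgreatest : IsGreatest (outputNorms Φ) (opNorm (Φ ρ)) := by
    refine ⟨⟨ρ, hρ, rfl⟩, ?_⟩
    rintro _ ⟨σ, hσ, rfl⟩
    exact hmax hσ
  exact ⟨ρ, hρ, hgreatest.csSup_eq.symm⟩

theorem maxOutputNorm_mem_Icc (hΦ : PreservesStates Φ) :
    maxOutputNorm Φ ∈ Set.Icc (1 / 2 : ℝ) 1 := by
  obtain ⟨ρ, hρ, h⟩ := normMaximizers_nonempty Φ
  rw [← h]
  exact ⟨(hΦ ρ hρ).half_le_opNorm, (hΦ ρ hρ).opNorm_le_one⟩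

theorem binaryEntropy_maxOutputNorm_le (hΦ : PreservesStates Φ) (hρ : IsState ρ) :
    binaryEntropy (maxOutputNorm Φ) ≤ vonNeumannEntropy (Φ ρ) := by
  have hstate := hΦ ρ hρ
  rw [hstate.vonNeumannEntropy_eq]
  exact antitoneOn_binaryEntropy ⟨hstate.half_le_opNorm, hstate.opNorm_le_one⟩
    (maxOutputNorm_mem_Icc hΦ) (opNorm_le_maxOutputNorm hΦ hρ)

theorem mem_upperBounds_holevoValues (hΦ : PreservesStates Φ) :
    1 - binaryEntropy (maxOutputNorm Φ) ∈ upperBounds (holevoValues Φ) := by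
  rintro _ ⟨p, ρ, σ, h0, h1, hρ, hσ, rfl⟩
  have hmix : vonNeumannEntropy (Φ (p • ρ + (1 - p) • σ)) ≤ 1 := by
    rw [(hΦ _ (hρ.mix hσ ⟨h0, h1⟩)).vonNeumannEntropy_eq]
    exact binaryEntropy_le_one _
  nlinarith [mul_le_mul_of_nonneg_left (binaryEntropy_maxOutputNorm_le hΦ hρ) h0,
    mul_le_mul_of_nonneg_left (binaryEntropy_maxOutputNorm_le hΦ hσ) (sub_nonneg.2 h1)]

theorem mem_holevoValues (hΦ : PreservesStates Φ) (hΦ1 : Φ 1 = 1) :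
    1 - binaryEntropy (maxOutputNorm Φ) ∈ holevoValues Φ := by
  obtain ⟨ρ, hρ, h⟩ := normMaximizers_nonempty Φ
  refine ⟨1 / 2, ρ, 1 - ρ, by norm_num, by norm_num, hρ, hρ.one_sub, ?_⟩
  have haverage : (1 / 2 : ℝ) • ρ + (1 - 1 / 2 : ℝ) • (1 - ρ) = (1 / 2 : ℝ) • (1 : Op) := by
    module
  rw [haverage, LinearMap.map_smul_of_tower, map_sub, hΦ1, vonNeumannEntropy_half_smul_one,
    (hΦ ρ hρ).vonNeumannEntropy_one_sub, (hΦ ρ hρ).vonNeumannEntropy_eq, h]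
  ring

theorem isGreatest_holevoValues (hΦ : PreservesStates Φ) (hΦ1 : Φ 1 = 1) :
    IsGreatest (holevoValues Φ) (1 - binaryEntropy (maxOutputNorm Φ)) :=
  ⟨mem_holevoValues hΦ hΦ1, mem_upperBounds_holevoValues hΦ⟩

theorem exists_isStarProjection_mem_detectors (hΦ : PreservesStates Φ)
    (hρ : ρ ∈ normMaximizers Φ) : ∃ τ ∈ detectors Φ ρ, IsStarProjection τ := by
  obtain ⟨τ, hτ, h, hproj⟩ := (hΦ ρ hρ.1).exists_isStarProjection_trace_mul_eq
  exact ⟨τ, ⟨hτ, by rw [h, hρ.2]⟩, hproj⟩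

theorem isStarProjection_measurement (hΦ : PreservesStates Φ) (hρ : ρ ∈ normMaximizers Φ)
    (hτ : τ ∈ detectors Φ ρ) (hne : maxOutputNorm Φ ≠ 1 / 2) (y : Fin 2) :
    IsStarProjection (measurement τ y) := by
  have hproj : IsStarProjection τ :=
    (hΦ ρ hρ.1).isStarProjection_of_trace_mul_eq hτ.1 (by rw [hρ.2, hτ.2]) (by rwa [hρ.2])
  fin_cases y
  · exact hproj.one_sub
  · exact hproj

theorem isPOVM_measurement (hτ : IsState τ) : IsPOVM (measurement τ) := by
  refine ⟨fun y => ?_, by simp [measurement]⟩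
  fin_cases y
  · exact hτ.one_sub.1
  · exact hτ.1

theorem isState_encoder (hρ : IsState ρ) (x : Fin 2) : IsState (encoder ρ x) := by
  fin_cases x
  · exact hρ
  · exact hρ.one_sub

theorem trace_measurement_mul_encoder (hΦ : PreservesStates Φ) (hΦ1 : Φ 1 = 1)
    (hρ : ρ ∈ normMaximizers Φ) (hτ : τ ∈ detectors Φ ρ) (x y : Fin 2) :
    (measurement τ y * Φ (encoder ρ x)).trace = (bsc (maxOutputNorm Φ) x y : ℂ) := by
  have htrace : (Φ ρ).trace = 1 := (hΦ ρ hρ.1).2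
  have hdetect : (τ * Φ ρ).trace = maxOutputNorm Φ := (Matrix.trace_mul_comm _ _).trans hτ.2
  fin_cases x <;> fin_cases y <;>
    simp [measurement, encoder, bsc, sub_mul, mul_sub, Matrix.trace_sub, hΦ1, hτ.1.2, htrace,
      hdetect]
  ring

theorem inducedChannel_eq_bsc (hΦ : PreservesStates Φ) (hΦ1 : Φ 1 = 1)
    (hρ : ρ ∈ normMaximizers Φ) (hτ : τ ∈ detectors Φ ρ) :
    inducedChannel Φ (encoder ρ) (measurement τ) = bsc (maxOutputNorm Φ) := by
  funext x y
  rw [inducedChannel, trace_measurement_mul_encoder hΦ hΦ1 hρ hτ, Complex.ofReal_re]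

end Channel

section TensorPower

variable {n : ℕ}

theorem productOp_mul (A B : Fin n → Op) :
    productOp A * productOp B = productOp fun i => A i * B i := by
  ext a b
  simp only [Matrix.mul_apply, productOp, Matrix.of_apply, Finset.prod_univ_sum,
    Fintype.piFinset_univ, Finset.prod_mul_distrib]

theorem trace_productOp (A : Fin n → Op) : (productOp A).trace = ∏ i, (A i).trace := by
  simp only [Matrix.trace, productOp, Matrix.diag, Matrix.of_apply, Finset.prod_univ_sum,
    Fintype.piFinset_univ]

theorem linearMap_apply_eq_sum_single (Φ : Op →ₗ[ℂ] Op) (A : Op) (c d : Fin 2) :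
    Φ A c d = ∑ a, ∑ b, A a b * Φ (Matrix.single a b 1) c d := by
  conv_lhs => rw [Matrix.matrix_eq_sum_single A]
  have hsingle (a b) : Matrix.single a b (A a b) = A a b • Matrix.single a b (1 : ℂ) := by
    rw [Matrix.smul_single, smul_eq_mul, mul_one]
  simp only [hsingle, map_sum, map_smul, Matrix.sum_apply, Matrix.smul_apply, smul_eq_mul]

theorem tensorPower_productOp (Φ : Op →ₗ[ℂ] Op) (A : Fin n → Op) :
    tensorPower Φ n (productOp A) = productOp fun i => Φ (A i) := by
  ext c d
  simp only [tensorPower, Matrix.sum_apply, Matrix.smul_apply, productOp, Matrix.of_apply,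
    smul_eq_mul, ← Finset.prod_mul_distrib]
  simp only [linearMap_apply_eq_sum_single Φ (A _), Finset.prod_univ_sum, Fintype.piFinset_univ]

theorem inducedBlockChannel_eq_re_prod (Φ : Op →ₗ[ℂ] Op) (E P : Fin 2 → Op) (x y : Fin n → Fin 2) :
    inducedBlockChannel Φ E P n x y = (∏ i, (P (y i) * Φ (E (x i))).trace).re := by
  rw [inducedBlockChannel, tensorPower_productOp, productOp_mul, trace_productOp]

theorem inducedBlockChannel_eq_memoryless {Φ : Op →ₗ[ℂ] Op} {ρ τ : Op} (hΦ : PreservesStates Φ)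
    (hΦ1 : Φ 1 = 1) (hρ : ρ ∈ normMaximizers Φ) (hτ : τ ∈ detectors Φ ρ) (n : ℕ) :
    inducedBlockChannel Φ (encoder ρ) (measurement τ) n
      = memoryless (bsc (maxOutputNorm Φ)) n := by
  funext x y
  simp only [inducedBlockChannel_eq_re_prod, trace_measurement_mul_encoder hΦ hΦ1 hρ hτ]
  rw [← Complex.ofReal_prod, Complex.ofReal_re, memoryless]

end TensorPower

end UnitalQubit

open UnitalQubit in
theorem mainTheorem1_general (Φ : Op →ₗ[ℂ] Op) (hΦ : PreservesStates Φ) (hΦ1 : Φ 1 = 1) :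
    BddAbove (outputNorms Φ) ∧
    BddAbove (holevoValues Φ) ∧
    maxOutputNorm Φ ∈ Set.Icc (1 / 2 : ℝ) 1 ∧
    (normMaximizers Φ).Nonempty ∧
    (∀ ρ ∈ normMaximizers Φ, ∃ τ ∈ detectors Φ ρ, IsStarProjection τ) ∧
    ∀ ρ ∈ normMaximizers Φ, ∀ τ ∈ detectors Φ ρ,
      (∀ x, IsState (encoder ρ x)) ∧
      IsPOVM (measurement τ) ∧
      (maxOutputNorm Φ ≠ 1 / 2 → ∀ y, IsStarProjection (measurement τ y)) ∧
      inducedChannel Φ (encoder ρ) (measurement τ) = bsc (maxOutputNorm Φ) ∧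
      (∀ n, inducedBlockChannel Φ (encoder ρ) (measurement τ) n
        = memoryless (bsc (maxOutputNorm Φ)) n) ∧
      shannonCapacity (inducedChannel Φ (encoder ρ) (measurement τ))
        ∈ mutualInformations (inducedChannel Φ (encoder ρ) (measurement τ)) ∧
      BddAbove (mutualInformations (inducedChannel Φ (encoder ρ) (measurement τ))) ∧
      shannonCapacity (inducedChannel Φ (encoder ρ) (measurement τ))
        = 1 - binaryEntropy (maxOutputNorm Φ) ∧
      1 - binaryEntropy (maxOutputNorm Φ) = holevoInformation Φ ∧
      (∃ c : (n : ℕ) → BlockCode n,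
        AchievesRate (memoryless (bsc (maxOutputNorm Φ))) c
          (shannonCapacity (bsc (maxOutputNorm Φ)))) ∧
      ∀ c : (n : ℕ) → BlockCode n,
        AchievesRate (memoryless (bsc (maxOutputNorm Φ))) c
          (shannonCapacity (bsc (maxOutputNorm Φ))) →
        AchievesRate (inducedBlockChannel Φ (encoder ρ) (measurement τ)) c
          (holevoInformation Φ) := by
  have hM := maxOutputNorm_mem_Icc hΦ
  have hχ := isGreatest_holevoValues hΦ hΦ1
  refine ⟨bddAbove_outputNorms hΦ, ⟨_, hχ.2⟩, hM, normMaximizers_nonempty Φ,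
    fun ρ hρ => exists_isStarProjection_mem_detectors hΦ hρ, fun ρ hρ τ hτ => ?_⟩
  have hI := isGreatest_mutualInformations_bsc (maxOutputNorm Φ)
  have hC := shannonCapacity_bsc (maxOutputNorm Φ)
  have hblock := inducedBlockChannel_eq_memoryless hΦ hΦ1 hρ hτ
  rw [inducedChannel_eq_bsc hΦ hΦ1 hρ hτ, funext hblock]
  refine ⟨isState_encoder hρ.1, isPOVM_measurement hτ.1, isStarProjection_measurement hΦ hρ hτ,
    rfl, fun _ => rfl, hC ▸ hI.1, ⟨_, hI.2⟩, hC, hχ.csSup_eq.symm,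
    exists_achievesRate_shannonCapacity_bsc ⟨by linarith [hM.1], hM.2⟩, fun c hc => ?_⟩
  rwa [holevoInformation, hχ.csSup_eq, ← hC]

theorem mainTheorem1 (Φ : UnitalQubit.Op →ₗ[ℂ] UnitalQubit.Op)
    (hΦ : UnitalQubit.IsUnitalQubitChannel Φ) :
    -- the suprema defining `M_Φ` and `χ(Φ)` are finite, and `M_Φ` is a valid flip probability
    BddAbove (UnitalQubit.outputNorms Φ) ∧
    BddAbove (UnitalQubit.holevoValues Φ) ∧
    UnitalQubit.maxOutputNorm Φ ∈ Set.Icc (1 / 2 : ℝ) 1 ∧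
    -- the scheme can be carried out, with a projective measurement
    (UnitalQubit.normMaximizers Φ).Nonempty ∧
    (∀ ρ ∈ UnitalQubit.normMaximizers Φ, ∃ τ ∈ UnitalQubit.detectors Φ ρ, IsStarProjection τ) ∧
    -- every choice of `ρ*` and `τ*` works
    ∀ ρ ∈ UnitalQubit.normMaximizers Φ, ∀ τ ∈ UnitalQubit.detectors Φ ρ,
      (∀ x, UnitalQubit.IsState (UnitalQubit.encoder ρ x)) ∧
      UnitalQubit.IsPOVM (UnitalQubit.measurement τ) ∧
      (UnitalQubit.maxOutputNorm Φ ≠ 1 / 2 →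
        ∀ y, IsStarProjection (UnitalQubit.measurement τ y)) ∧
      -- the induced classical channel is a memoryless binary symmetric channel
      UnitalQubit.inducedChannel Φ (UnitalQubit.encoder ρ) (UnitalQubit.measurement τ)
        = UnitalQubit.bsc (UnitalQubit.maxOutputNorm Φ) ∧
      (∀ n, UnitalQubit.inducedBlockChannel Φ (UnitalQubit.encoder ρ) (UnitalQubit.measurement τ) n
        = UnitalQubit.memoryless (UnitalQubit.bsc (UnitalQubit.maxOutputNorm Φ)) n) ∧
      -- its Shannon capacity is a maximum, and equals `1 - h(M_Φ) = χ(Φ)`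
      UnitalQubit.shannonCapacity
          (UnitalQubit.inducedChannel Φ (UnitalQubit.encoder ρ) (UnitalQubit.measurement τ))
        ∈ UnitalQubit.mutualInformations
          (UnitalQubit.inducedChannel Φ (UnitalQubit.encoder ρ) (UnitalQubit.measurement τ)) ∧
      BddAbove (UnitalQubit.mutualInformations
        (UnitalQubit.inducedChannel Φ (UnitalQubit.encoder ρ) (UnitalQubit.measurement τ))) ∧
      UnitalQubit.shannonCapacity
          (UnitalQubit.inducedChannel Φ (UnitalQubit.encoder ρ) (UnitalQubit.measurement τ))
        = 1 - UnitalQubit.binaryEntropy (UnitalQubit.maxOutputNorm Φ) ∧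
      1 - UnitalQubit.binaryEntropy (UnitalQubit.maxOutputNorm Φ)
        = UnitalQubit.holevoInformation Φ ∧
      -- capacity-achieving codes for the binary symmetric channel exist, and any such sequence of
      -- codes, used with the scheme over `n` independent uses of `Φ`, achieves `χ(Φ)`
      (∃ c : (n : ℕ) → UnitalQubit.BlockCode n,
        UnitalQubit.AchievesRate
          (UnitalQubit.memoryless (UnitalQubit.bsc (UnitalQubit.maxOutputNorm Φ))) c
          (UnitalQubit.shannonCapacity (UnitalQubit.bsc (UnitalQubit.maxOutputNorm Φ)))) ∧
      ∀ c : (n : ℕ) → UnitalQubit.BlockCode n,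
        UnitalQubit.AchievesRate
          (UnitalQubit.memoryless (UnitalQubit.bsc (UnitalQubit.maxOutputNorm Φ))) c
          (UnitalQubit.shannonCapacity (UnitalQubit.bsc (UnitalQubit.maxOutputNorm Φ))) →
        UnitalQubit.AchievesRate
          (UnitalQubit.inducedBlockChannel Φ (UnitalQubit.encoder ρ) (UnitalQubit.measurement τ)) c
          (UnitalQubit.holevoInformation Φ) :=
  mainTheorem1_general Φ hΦ.preservesStates hΦ.unital
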